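/- **Setting.** There are three items $i\in\{1,2,3\}$ and two slots. Item $i$ can be shown as an ad or in organic form, with click-through rates $0\le\alpha_i^A<\alpha_i^O\le 1$ and user-experience effects $0\le\gamma_i^A\le\gamma_i^O$. Owner $i$ submits a bid $b_i\in[0,B_i]$, $B_i>0$; bids are independent, and $b_i$ has a distribution $F_i$ with density $f_i$, positive on $(0,B_i)$ and zero outside $[0,B_i]$, that is regular: $\phi_i(b)=b-\frac{1-F_i(b)}{f_i(b)}$ is non-decreasing on $(0,B_i)$ (at an end point where $f_i$ vanishes, the quotient is read as $0$). Put $a_i=\phi_i(b_i)\alpha_i^A+\gamma_i^A$. A (deterministic, measurable) mechanism consists of $x_i(\boldsymbol b),y_i(\boldsymbol b)\in\{0,1\}$ (the ad, respectively the organic form of item $i$ is displayed) and per-click payments $p_i(\boldsymbol b)\ge 0$ with $p_i(\boldsymbol b)=0$ if $x_i(\boldsymbol b)=0$. Write $X_i=x_i\alpha_i^A+y_i\alpha_i^O$ and $P_i=p_ix_i\alpha_i^A$. The mechanism is feasible if $\sum_i(x_i+y_i)\le 2$ and $x_i+y_i\le 1$ for all $i$; it is incentive compatible if $b_iX_i(\boldsymbol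 b)-P_i(\boldsymbol b)\ge b_iX_i(b_i',\boldsymbol b_{-i})-P_i(b_i',\boldsymbol b_{-i})$ for all $i$, $\boldsymbol b$ and $b_i'$; it is individually rational if $p_i(\boldsymbol b)\le b_i$ for all $i$ and $\boldsymbol b$. An optimal 2-out-of-3 mechanism maximizes $$\mathbb E\Big[\sum_i p_ix_i\alpha_i^A\Big]+\mathbb E\Big[\sum_i(x_i\gamma_i^A+y_i\gamma_i^O)\Big]$$ among all feasible, incentive compatible and individually rational mechanisms. **Theorem.** There exist an optimal 2-out-of-3 mechanism $(x^*,y^*,p^*)$, a permutation $(i_1,i_2,i_3)$ of the three items, and functions $g_1,g_2$ such that for every bid profile $$y^*_{i_1}\ge y^*_{i_2}\ge y^*_{i_3},\qquad y^*_{i_1}=g_1(a_{i_2},a_{i_3}),\qquad y^*_{i_2}=g_2(a_{i_3}),\qquad y^*_{i_3}=0 .$$ Moreover, whenever the organic allocation of an optimal mechanism is essentially unique (all optimal mechanisms have the same $y$ almost surely), every optimal mechanism satisfies, for some permutation $(i_1,i_2,i_3)$ and functions $g_1,g_2$, these relations for almost every bid profile. -/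

import Mathlib

namespace MergingProblem

/-- Virtual value `φ(b) = b - (1 - F(b)) / f(b)` of a distribution on the real line with density `f`
and distribution function `F(b) = ∫_{t ≤ b} f(t) dt`. -/
noncomputable def virtualValue (f : ℝ → ℝ) (b : ℝ) : ℝ :=
  b - (1 - ∫ t in Set.Iic b, f t) / f b

/-- `f` is the density of a regular probability distribution with support `[0, B]`: the virtual value
is non-decreasing. Positivity and monotonicity are required in the interior only, so that densities
that vanish at an end point (where the virtual value may be infinite) are allowed. -/
structure IsRegularDensity (f : ℝ → ℝ) (B : ℝ) : Prop where
  measurable : Measurable f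
  pos : ∀ t ∈ Set.Ioo 0 B, 0 < f t
  nonneg : ∀ t, 0 ≤ f t
  eq_zero : ∀ t, t ∉ Set.Icc 0 B → f t = 0
  lintegral_eq_one : ∫⁻ t, ENNReal.ofReal (f t) = 1
  regular : MonotoneOn (virtualValue f) (Set.Ioo 0 B)

/-- The data of a merging problem with `n` items. -/
structure Instance (n : ℕ) where
  /-- click-through rate of the ad form -/
  ctrAd : Fin n → ℝ
  /-- click-through rate of the organic form -/
  ctrOrg : Fin n → ℝ
  /-- user experience of the ad form -/
  ueAd : Fin n → ℝ
  /-- user experience of the organic form -/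
  ueOrg : Fin n → ℝ
  /-- the bid of owner `i` lies in `[0, maxBid i]` -/
  maxBid : Fin n → ℝ
  /-- density of the prior distribution of the bid of owner `i` -/
  density : Fin n → ℝ → ℝ
  ctrAd_nonneg : ∀ i, 0 ≤ ctrAd i
  ctrAd_lt_ctrOrg : ∀ i, ctrAd i < ctrOrg i
  ctrOrg_le_one : ∀ i, ctrOrg i ≤ 1
  ueAd_nonneg : ∀ i, 0 ≤ ueAd i
  ueAd_le_ueOrg : ∀ i, ueAd i ≤ ueOrg i
  maxBid_pos : ∀ i, 0 < maxBid i
  isRegularDensity : ∀ i, IsRegularDensity (density i) (maxBid i)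

/-- A merging mechanism `(x, y, p)`: `x b i = 1` if the ad form of item `i` is displayed, `y b i = 1`
if its organic form is displayed, and `p b i` is the payment charged to owner `i` per click on the
ad form. -/
structure Mechanism (n : ℕ) where
  x : (Fin n → ℝ) → Fin n → ℝ
  y : (Fin n → ℝ) → Fin n → ℝ
  p : (Fin n → ℝ) → Fin n → ℝ
  x_binary : ∀ b i, x b i = 0 ∨ x b i = 1
  y_binary : ∀ b i, y b i = 0 ∨ y b i = 1
  p_nonneg : ∀ b i, 0 ≤ p b i
  p_eq_zero : ∀ b i, x b i = 0 → p b i = 0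
  measurable_x : Measurable x
  measurable_y : Measurable y
  measurable_p : Measurable p

namespace Instance

variable {n : ℕ} (E : Instance n)

/-- The possible bid profiles. -/
def bids : Set (Fin n → ℝ) := {b | ∀ i, b i ∈ Set.Icc 0 (E.maxBid i)}

/-- The prior distribution of the bid of owner `i`. -/
noncomputable def prior (i : Fin n) : MeasureTheory.Measure ℝ :=
  MeasureTheory.volume.withDensity fun t => ENNReal.ofReal (E.density i t)

/-- The joint distribution of the (independent) bids. -/
noncomputable def jointPrior : MeasureTheory.Measure (Fin n → ℝ) :=
  MeasureTheory.Measure.pi E.prior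

/-- Expected click-through rate of item `i`. -/
def clickRate (M : Mechanism n) (b : Fin n → ℝ) (i : Fin n) : ℝ :=
  M.x b i * E.ctrAd i + M.y b i * E.ctrOrg i

/-- Expected payment of owner `i`. -/
def payment (M : Mechanism n) (b : Fin n → ℝ) (i : Fin n) : ℝ :=
  M.p b i * (M.x b i * E.ctrAd i)

/-- Feasibility with `k` slots. -/
def IsFeasible (k : ℕ) (M : Mechanism n) : Prop :=
  ∀ b ∈ E.bids, (∑ i, (M.x b i + M.y b i) ≤ k) ∧ ∀ i, M.x b i + M.y b i ≤ 1

/-- Incentive compatibility. -/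
def IsIC (M : Mechanism n) : Prop :=
  ∀ b ∈ E.bids, ∀ i, ∀ c ∈ Set.Icc 0 (E.maxBid i),
    b i * E.clickRate M (Function.update b i c) i - E.payment M (Function.update b i c) i
      ≤ b i * E.clickRate M b i - E.payment M b i

/-- Individual rationality. -/
def IsIR (M : Mechanism n) : Prop :=
  ∀ b ∈ E.bids, ∀ i, M.p b i ≤ b i

/-- Expected revenue. -/
noncomputable def revenue (M : Mechanism n) : ℝ :=
  ∫ b, ∑ i, M.p b i * M.x b i * E.ctrAd i ∂E.jointPrior

/-- Expected user experience. -/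
noncomputable def userExperience (M : Mechanism n) : ℝ :=
  ∫ b, ∑ i, (M.x b i * E.ueAd i + M.y b i * E.ueOrg i) ∂E.jointPrior

/-- Objective of the platform. -/
noncomputable def objective (M : Mechanism n) : ℝ :=
  E.revenue M + E.userExperience M

/-- IC, IR and feasible with `k` slots. -/
def IsAdmissible (k : ℕ) (M : Mechanism n) : Prop :=
  E.IsIC M ∧ E.IsIR M ∧ E.IsFeasible k M

/-- `M` is an optimal `k`-out-of-`n` mechanism. -/
def IsOptimal (k : ℕ) (M : Mechanism n) : Prop :=
  E.IsAdmissible k M ∧ ∀ N : Mechanism n, E.IsAdmissible k N → E.objective N ≤ E.objective M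

/-- The contribution `a_i = φ_i(b_i) α_i^A + γ_i^A` of the ad form of item `i`. -/
noncomputable def contribution (b : Fin n → ℝ) (i : Fin n) : ℝ :=
  virtualValue (E.density i) (b i) * E.ctrAd i + E.ueAd i

end Instance

/-- At the bid profile `b`, the organic allocation of `M` respects the order `(i₁, i₂, i₃)`, with
`y_{i₁} = g₁(a_{i₂}, a_{i₃})`, `y_{i₂} = g₂(a_{i₃})` and `y_{i₃} = 0`. -/
def OrderedAt (E : Instance 3) (M : Mechanism 3) (i₁ i₂ i₃ : Fin 3) (g₁ : ℝ → ℝ → ℝ) (g₂ : ℝ → ℝ)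
    (b : Fin 3 → ℝ) : Prop :=
  M.y b i₂ ≤ M.y b i₁ ∧ M.y b i₃ ≤ M.y b i₂ ∧
    M.y b i₁ = g₁ (E.contribution b i₂) (E.contribution b i₃) ∧
    M.y b i₂ = g₂ (E.contribution b i₃) ∧
    M.y b i₃ = 0

end MergingProblem

namespace MergingProblem

open MeasureTheory Set

/-! Incentive compatibility makes the organic display of an item independent of its owner's bid, up
to the bid `0`: organic clicks are free and strictly more numerous than ad clicks. Myerson's
argument then fixes the payments, and the objective becomes the expectation of `∑ x_i a_i + y_i
γ_i^O` (`IsAdmissible.objective_eq`).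

The rest resembles Weitzman's index argument. With `v_i = max a_i 0`, choose `t_i` such that `𝔼
max(v_i, t_i) = γ_i^O`. As `y_i` is independent of `b_i`, the constant `γ_i^O` may be replaced by
the random `κ_i = max(v_i, t_i)` (`IsAdmissible.integral_y_mul`). Every displayed form of item `i`
is then worth at most `κ_i`, so no admissible mechanism exceeds the expected sum of the two largest
`κ_i` (`IsAdmissible.objective_le`).

The bound is attained. Sort the items by decreasing index; show the first organically unless both
later ads beat its index, the second unless the third ad beats its index, the third never; fill the
remaining slots with the best positive ads (`topTwo_le_surplus`). These tests use only the ads of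
later items, which is the claimed structure. If the optimal organic allocation is essentially
unique, it is this one. -/

/-- The distribution on the real line with density `f`. -/
noncomputable def law (f : ℝ → ℝ) : Measure ℝ :=
  volume.withDensity fun t => ENNReal.ofReal (f t)

/-! ### Virtual values and Myerson's identity for one bidder -/

namespace IsRegularDensity

variable {f : ℝ → ℝ} {B : ℝ}

theorem isProbabilityMeasure (hf : IsRegularDensity f B) : IsProbabilityMeasure (law f) :=
  ⟨by rw [law, withDensity_apply _ MeasurableSet.univ]; simpa using hf.lintegral_eq_one⟩

theorem ae_mem_Ioo (hf : IsRegularDensity f B) : ∀ᵐ t ∂law f, t ∈ Ioo 0 B := by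
  rw [law, ae_withDensity_iff hf.measurable.ennreal_ofReal]
  filter_upwards [Measure.ae_ne volume (0 : ℝ), Measure.ae_ne volume B] with t h0 hB h
  have : t ∈ Icc 0 B := by
    by_contra hc
    simp [hf.eq_zero t hc] at h
  exact ⟨lt_of_le_of_ne this.1 h0.symm, lt_of_le_of_ne this.2 hB⟩

theorem setIntegral_eq (hf : IsRegularDensity f B) {s : Set ℝ} (hs : MeasurableSet s) :
    ∫ t in s, f t = (law f).real s := by
  rw [integral_eq_lintegral_of_nonneg_ae (Filter.Eventually.of_forall hf.nonneg)
    hf.measurable.aestronglyMeasurable, Measure.real, law, withDensity_apply _ hs]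

theorem virtualValue_eq (hf : IsRegularDensity f B) (b : ℝ) :
    virtualValue f b = b - (law f).real (Ioi b) / f b := by
  have := hf.isProbabilityMeasure
  rw [virtualValue, hf.setIntegral_eq measurableSet_Iic, ← probReal_compl_eq_one_sub
    measurableSet_Iic, compl_Iic]

theorem virtualValue_le (hf : IsRegularDensity f B) (b : ℝ) : virtualValue f b ≤ b := by
  rw [hf.virtualValue_eq, sub_le_self_iff]
  exact div_nonneg measureReal_nonneg (hf.nonneg b)

theorem measurable_tail (hf : IsRegularDensity f B) :
    Measurable fun b => (law f).real (Ioi b) := by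
  have := hf.isProbabilityMeasure
  have : Antitone fun b => (law f).real (Ioi b) := fun s t h =>
    measureReal_mono (Ioi_subset_Ioi h)
  exact this.measurable

theorem measurable_virtualValue (hf : IsRegularDensity f B) : Measurable (virtualValue f) := by
  rw [funext hf.virtualValue_eq]
  exact measurable_id.sub (hf.measurable_tail.div hf.measurable)

/-- At the right end point the tail vanishes, so the virtual value there is `B`, whatever the
density. The left end point stays excluded: if `f 0 = 0`, division by zero gives the virtual value
`0`, which may exceed those just to the right. -/
theorem virtualValue_monotoneOn (hf : IsRegularDensity f B) :
    MonotoneOn (virtualValue f) (Ioc 0 B) := by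
  have := hf.isProbabilityMeasure
  intro s hs t ht hst
  rcases eq_or_lt_of_le ht.2 with rfl | htB
  · refine (hf.virtualValue_le s).trans (hst.trans (le_of_eq ?_))
    have h0 : (law f) (Ioi t) = 0 := by
      rw [measure_eq_zero_iff_ae_notMem]
      filter_upwards [hf.ae_mem_Ioo] with r hr
      simpa using hr.2.le
    rw [hf.virtualValue_eq, Measure.real, h0]
    simp
  · exact hf.regular ⟨hs.1, hst.trans_lt htB⟩ ⟨ht.1, htB⟩ hst

/-- Change of variables from the law with density `f` to Lebesgue measure on the support. -/
theorem integral_div_mul (hf : IsRegularDensity f B) (g : ℝ → ℝ) :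
    ∫ b, g b / f b ∂law f = ∫ b in Ioo 0 B, g b := by
  rw [law, integral_withDensity_eq_integral_toReal_smul hf.measurable.ennreal_ofReal
    (Filter.Eventually.of_forall fun _ => ENNReal.ofReal_lt_top),
    ← integral_indicator measurableSet_Ioo]
  refine integral_congr_ae ?_
  filter_upwards [Measure.ae_ne volume (0 : ℝ), Measure.ae_ne volume B] with t h0 hB
  by_cases ht : t ∈ Ioo 0 B
  · have := hf.pos t ht
    rw [indicator_of_mem ht, ENNReal.toReal_ofReal this.le, smul_eq_mul]
    field_simp
  · have : t ∉ Icc 0 B := fun h =>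
      ht ⟨lt_of_le_of_ne h.1 h0.symm, lt_of_le_of_ne h.2 hB⟩
    rw [indicator_of_notMem ht, hf.eq_zero t this]
    simp

/-- The density cancels the denominator and leaves a tail probability, at most one, on a bounded
support. -/
theorem integrable_tail_div (hf : IsRegularDensity f B) :
    Integrable (fun b => (law f).real (Ioi b) / f b) (law f) := by
  have := hf.isProbabilityMeasure
  rw [law, integrable_withDensity_iff_integrable_smul' hf.measurable.ennreal_ofReal
    (Filter.Eventually.of_forall fun _ => ENNReal.ofReal_lt_top)]
  have h : Integrable ((Icc 0 B).indicator fun _ => (1 : ℝ)) :=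
    (integrable_indicator_iff measurableSet_Icc).2 (by simp)
  refine h.mono ?_ (Filter.Eventually.of_forall fun t => ?_)
  · exact (hf.measurable.ennreal_ofReal.ennreal_toReal.smul
      (hf.measurable_tail.div hf.measurable)).aestronglyMeasurable
  · rw [ENNReal.toReal_ofReal (hf.nonneg t), smul_eq_mul]
    by_cases ht : t ∈ Icc 0 B
    · rw [indicator_of_mem ht]
      rcases eq_or_ne (f t) 0 with h0 | h0
      · simp [h0]
      · have h1 : f t * ((law f).real (Ioi t) / f t) = (law f).real (Ioi t) := by field_simp
        simp only [law] at h1 ⊢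
        rw [h1, Real.norm_of_nonneg measureReal_nonneg, norm_one]
        exact measureReal_le_one (μ := law f)
    · simp [hf.eq_zero t ht]

theorem integrable_id (hf : IsRegularDensity f B) : Integrable (fun b => b) (law f) := by
  have := hf.isProbabilityMeasure
  refine Integrable.of_bound measurable_id.aestronglyMeasurable B ?_
  filter_upwards [hf.ae_mem_Ioo] with b hb
  rw [Real.norm_of_nonneg hb.1.le]
  exact hb.2.le

theorem integrable_virtualValue (hf : IsRegularDensity f B) :
    Integrable (virtualValue f) (law f) := by
  rw [funext hf.virtualValue_eq]
  exact hf.integrable_id.sub hf.integrable_tail_div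

theorem integrable_mul_allocation {μ : Measure ℝ} {g x : ℝ → ℝ}
    (hg : Integrable g μ) (hx : Measurable x) (hx0 : ∀ t, 0 ≤ x t) (hx1 : ∀ t, x t ≤ 1) :
    Integrable (fun b => g b * x b) μ := by
  refine hg.mul_bdd (c := 1) hx.aestronglyMeasurable (Filter.Eventually.of_forall fun t => ?_)
  rw [Real.norm_of_nonneg (hx0 t)]
  exact hx1 t

/-- The expected Myerson payment of an allocation rule is its expected virtual value. -/
theorem integral_payment (hf : IsRegularDensity f B) {x : ℝ → ℝ} (hx : Measurable x)
    (hx0 : ∀ t, 0 ≤ x t) (hx1 : ∀ t, x t ≤ 1) :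
    ∫ b, (b * x b - ∫ t in (0 : ℝ)..b, x t) ∂law f = ∫ b, virtualValue f b * x b ∂law f := by
  have := hf.isProbabilityMeasure
  have hmeas : MeasurableSet {q : ℝ × ℝ | q.2 < q.1} :=
    measurableSet_lt measurable_snd measurable_fst
  have hint : Integrable (Function.uncurry fun b t => (Iio b).indicator x t)
      ((law f).prod (volume.restrict (Ioo 0 B))) := by
    refine Integrable.of_bound ?_ 1 (Filter.Eventually.of_forall fun q => ?_)
    · have : (Function.uncurry fun b t => (Iio b).indicator x t) =
          {q : ℝ × ℝ | q.2 < q.1}.indicator fun q => x q.2 := by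
        ext q
        simp [Function.uncurry, indicator]
      rw [this]
      exact ((hx.comp measurable_snd).indicator hmeas).aestronglyMeasurable
    · simp only [Function.uncurry, indicator]
      split_ifs
      · rw [Real.norm_of_nonneg (hx0 _)]; exact hx1 _
      · simp
  have hinner : ∀ᵐ b ∂law f, ∫ t in (0 : ℝ)..b, x t =
      ∫ t in Ioo 0 B, (Iio b).indicator x t := by
    filter_upwards [hf.ae_mem_Ioo] with b hb
    rw [intervalIntegral.integral_of_le hb.1.le, ← integral_Ioc_eq_integral_Ioo,
      integral_Ioc_eq_integral_Ioo, integral_Ioc_eq_integral_Ioo,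
      setIntegral_indicator measurableSet_Iio]
    congr 2
    ext t
    simp only [mem_Ioo, mem_inter_iff, mem_Iio]
    constructor
    · rintro ⟨h1, h2⟩; exact ⟨⟨h1, h2.trans hb.2⟩, h2⟩
    · rintro ⟨⟨h1, _⟩, h2⟩; exact ⟨h1, h2⟩
  -- Fubini: the level `t` is counted by all bids above `t`, hence with the weight of the tail
  -- beyond `t`.
  have hswap : ∫ b, (∫ t in (0 : ℝ)..b, x t) ∂law f =
      ∫ b, (law f).real (Ioi b) / f b * x b ∂law f := by
    rw [integral_congr_ae hinner, integral_integral_swap hint]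
    have : (fun b => (law f).real (Ioi b) / f b * x b) =
        fun b => ((law f).real (Ioi b) * x b) / f b := by
      ext b; ring
    rw [this, hf.integral_div_mul]
    refine integral_congr_ae (Filter.Eventually.of_forall fun t => ?_)
    have : (fun b => (Iio b).indicator x t) = (Ioi t).indicator fun _ => x t := by
      ext b; simp [indicator]
    simp only [this]
    rw [integral_indicator_const _ measurableSet_Ioi, smul_eq_mul]
  have hI : Integrable (fun b => ∫ t in (0 : ℝ)..b, x t) (law f) :=
    hint.integral_prod_left.congr (hinner.mono fun b hb => hb.symm)
  rw [integral_sub (integrable_mul_allocation hf.integrable_id hx hx0 hx1) hI, hswap,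
    ← integral_sub (integrable_mul_allocation hf.integrable_id hx hx0 hx1)
      (integrable_mul_allocation hf.integrable_tail_div hx hx0 hx1)]
  simp_rw [hf.virtualValue_eq, sub_mul]

end IsRegularDensity

/-! ### Integrating out one coordinate of a product measure -/

section Resampling

variable {ι : Type*} [Fintype ι] [DecidableEq ι] (μ : ι → Measure ℝ)
  [∀ i, IsProbabilityMeasure (μ i)]

/-- Resampling one coordinate of a product measure independently preserves it. -/
theorem measurePreserving_update (i : ι) :
    MeasurePreserving (fun q : (ι → ℝ) × ℝ => Function.update q.1 i q.2)
      ((Measure.pi μ).prod (μ i)) (Measure.pi μ) := by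
  have hm : Measurable fun q : (ι → ℝ) × ℝ => Function.update q.1 i q.2 := by
    refine measurable_pi_iff.2 fun j => ?_
    by_cases h : j = i
    · subst h; simpa using measurable_snd
    · simp only [Function.update_of_ne h]
      fun_prop
  refine ⟨hm, (Measure.pi_eq fun s hs => ?_).symm⟩
  rw [Measure.map_apply hm (MeasurableSet.univ_pi hs)]
  have : (fun q : (ι → ℝ) × ℝ => Function.update q.1 i q.2) ⁻¹' univ.pi s =
      (univ.pi (Function.update s i univ)) ×ˢ s i := by
    ext q
    simp only [mem_preimage, mem_pi, mem_univ, true_implies, mem_prod]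
    constructor
    · refine fun h => ⟨fun j => ?_, by simpa using h i⟩
      by_cases hj : j = i
      · subst hj; simp
      · simpa [Function.update_of_ne hj] using h j
    · rintro ⟨h, h'⟩ j
      by_cases hj : j = i
      · subst hj; simpa using h'
      · simpa [Function.update_of_ne hj] using h j
  rw [this, Measure.prod_prod, Measure.pi_pi, ← Finset.prod_erase_mul _ _ (Finset.mem_univ i),
    ← Finset.prod_erase_mul Finset.univ (fun j => μ j (s j)) (Finset.mem_univ i)]
  simp only [Function.update_self, measure_univ, mul_one]
  congr 1
  refine Finset.prod_congr rfl fun j hj => ?_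
  rw [Function.update_of_ne (Finset.ne_of_mem_erase hj)]

/-- Allows one owner's bid to be averaged with the other bids fixed, without splitting the product
space. -/
theorem integral_eq_integral_update (i : ι) {g : (ι → ℝ) → ℝ} (hg : Integrable g (Measure.pi μ)) :
    ∫ b, g b ∂Measure.pi μ = ∫ b, ∫ t, g (Function.update b i t) ∂μ i ∂Measure.pi μ := by
  have h := measurePreserving_update μ i
  have h1 : ∫ b, g b ∂Measure.pi μ =
      ∫ q, g (Function.update q.1 i q.2) ∂(Measure.pi μ).prod (μ i) := by
    conv_lhs => rw [← h.map_eq]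
    exact integral_map h.measurable.aemeasurable (h.map_eq.symm ▸ hg.aestronglyMeasurable)
  rw [h1]
  exact integral_prod _ (h.integrable_comp_of_integrable hg)

end Resampling

/-! ### Bid profiles and elementary bounds for mechanisms -/

namespace Instance

variable {n : ℕ} (E : Instance n)

instance (i : Fin n) : IsProbabilityMeasure (E.prior i) :=
  (E.isRegularDensity i).isProbabilityMeasure

instance : IsProbabilityMeasure E.jointPrior :=
  inferInstanceAs (IsProbabilityMeasure (Measure.pi E.prior))

theorem ae_mem_Ioo : ∀ᵐ b ∂E.jointPrior, ∀ i, b i ∈ Ioo 0 (E.maxBid i) := by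
  rw [ae_all_iff]
  intro i
  exact (measurePreserving_eval E.prior i).quasiMeasurePreserving.ae
    (E.isRegularDensity i).ae_mem_Ioo

theorem ae_mem_bids : ∀ᵐ b ∂E.jointPrior, b ∈ E.bids :=
  E.ae_mem_Ioo.mono fun _ hb i => Ioo_subset_Icc_self (hb i)

variable {E}

theorem update_mem_bids {b : Fin n → ℝ} (hb : b ∈ E.bids) {i : Fin n} {t : ℝ}
    (ht : t ∈ Icc 0 (E.maxBid i)) : Function.update b i t ∈ E.bids := by
  intro j
  by_cases h : j = i
  · subst h; simpa using ht
  · simpa [Function.update_of_ne h] using hb j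

theorem integrable_comp_eval {g : ℝ → ℝ} {i : Fin n} (hg : Integrable g (E.prior i)) :
    Integrable (fun b => g (b i)) E.jointPrior :=
  (measurePreserving_eval E.prior i).integrable_comp_of_integrable hg

end Instance

namespace Mechanism

variable {n : ℕ} (M : Mechanism n)

theorem x_nonneg (b i) : 0 ≤ M.x b i := by rcases M.x_binary b i with h | h <;> simp [h]

theorem x_le_one (b i) : M.x b i ≤ 1 := by rcases M.x_binary b i with h | h <;> simp [h]

theorem y_nonneg (b i) : 0 ≤ M.y b i := by rcases M.y_binary b i with h | h <;> simp [h]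

theorem y_le_one (b i) : M.y b i ≤ 1 := by rcases M.y_binary b i with h | h <;> simp [h]

theorem measurable_x_apply (i) : Measurable fun b => M.x b i :=
  (measurable_pi_apply i).comp M.measurable_x

theorem measurable_y_apply (i) : Measurable fun b => M.y b i :=
  (measurable_pi_apply i).comp M.measurable_y

theorem measurable_p_apply (i) : Measurable fun b => M.p b i :=
  (measurable_pi_apply i).comp M.measurable_p

theorem p_mul_x (b i) : M.p b i * M.x b i = M.p b i := by
  rcases M.x_binary b i with h | h
  · simp [M.p_eq_zero b i h]
  · simp [h]

end Mechanism

namespace Instance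

variable {n : ℕ} {E : Instance n}

theorem integrable_mul_of_unit {g h : (Fin n → ℝ) → ℝ} (hg : Integrable g E.jointPrior)
    (hh : Measurable h) (h0 : ∀ b, 0 ≤ h b) (h1 : ∀ b, h b ≤ 1) :
    Integrable (fun b => h b * g b) E.jointPrior := by
  refine hg.bdd_mul (c := 1) hh.aestronglyMeasurable (Filter.Eventually.of_forall fun b => ?_)
  rw [Real.norm_of_nonneg (h0 b)]
  exact h1 b

/-! ### Consequences of incentive compatibility and individual rationality -/

section Admissible

variable {k : ℕ} {M : Mechanism n}

theorem IsAdmissible.x_eq_zero (hM : E.IsAdmissible k M) {b : Fin n → ℝ} (hb : b ∈ E.bids)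
    {i : Fin n} (hy : M.y b i = 1) : M.x b i = 0 := by
  have := (hM.2.2 b hb).2 i
  rcases M.x_binary b i with h | h
  · exact h
  · rw [h, hy] at this; norm_num at this

/-- By incentive compatibility, an item displayed organically for some bid of its owner is
displayed organically for all positive bids of its owner. -/
theorem IsAdmissible.y_eq_one (hM : E.IsAdmissible k M) {b : Fin n → ℝ} (hb : b ∈ E.bids)
    {i : Fin n} (hi : 0 < b i) {c : ℝ} (hc : c ∈ Icc 0 (E.maxBid i))
    (hy : M.y (Function.update b i c) i = 1) : M.y b i = 1 := by
  have hx := hM.x_eq_zero (update_mem_bids hb hc) hy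
  have h := hM.1 b hb i c hc
  simp only [clickRate, payment, hx, hy] at h
  have hlt := E.ctrAd_lt_ctrOrg i
  have h0 := E.ctrAd_nonneg i
  rcases M.y_binary b i with hyb | hyb
  -- The deviation yields `b i * α^O` free of charge, the truthful bid at most `b i * α^A`, which is
  -- smaller as `b i > 0`.
  · exfalso
    have hp := M.p_nonneg b i
    rcases M.x_binary b i with hxb | hxb <;> rw [hxb, hyb] at h <;> nlinarith [mul_nonneg hp h0]
  · exact hyb

/-- Both directions of `y_eq_one`. The bid `0` is excluded because its owner does not value clicks.
-/
theorem IsAdmissible.y_update (hM : E.IsAdmissible k M) {b : Fin n → ℝ} (hb : b ∈ E.bids)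
    {i : Fin n} (hi : 0 < b i) {c : ℝ} (hc : c ∈ Ioc 0 (E.maxBid i)) :
    M.y (Function.update b i c) i = M.y b i := by
  have hc' : c ∈ Icc 0 (E.maxBid i) := Ioc_subset_Icc_self hc
  rcases M.y_binary (Function.update b i c) i with h | h
  · rcases M.y_binary b i with h' | h'
    · rw [h, h']
    · have := hM.y_eq_one (update_mem_bids hb hc') (i := i) (by simpa using hc.1) (hb i)
        (by simpa using h')
      rw [this, h']
  · rw [h, hM.y_eq_one hb hi hc' h]

/-- Payments are determined by the ad allocation. -/
theorem IsAdmissible.p_eq (hM : E.IsAdmissible k M) {b : Fin n → ℝ} (hb : b ∈ E.bids)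
    {i : Fin n} (hα : 0 < E.ctrAd i) (hi : 0 < b i) :
    M.p b i * M.x b i =
      b i * M.x b i - ∫ t in (0 : ℝ)..b i, M.x (Function.update b i t) i := by
  have hsub : ∀ t ∈ Ioc 0 (b i), t ∈ Ioc 0 (E.maxBid i) := fun t ht => ⟨ht.1, ht.2.trans (hb i).2⟩
  have hxt : ∀ {t}, t ∈ Ioc 0 (E.maxBid i) → M.x (Function.update b i t) i = 1 →
      M.y b i = 0 := by
    intro t ht hx
    rcases M.y_binary b i with h | h
    · exact h
    · have := hM.x_eq_zero (update_mem_bids hb (Ioc_subset_Icc_self ht))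
        ((hM.y_update hb hi ht).trans h)
      rw [hx] at this; norm_num at this
  -- With no organic display at any positive report, incentive compatibility can be divided by the
  -- click-through rate of the ad.
  have key : ∀ {s t}, s ∈ Ioc 0 (E.maxBid i) → t ∈ Ioc 0 (E.maxBid i) → M.y b i = 0 →
      s * M.x (Function.update b i t) i - M.p (Function.update b i t) i ≤
        s * M.x (Function.update b i s) i - M.p (Function.update b i s) i := by
    intro s t hs ht hy
    have h := hM.1 _ (update_mem_bids hb (Ioc_subset_Icc_self hs)) i t (Ioc_subset_Icc_self ht)
    simp only [clickRate, payment, Function.update_idem, Function.update_self,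
      hM.y_update hb hi hs, hM.y_update hb hi ht, hy, ← mul_assoc, M.p_mul_x] at h
    refine le_of_mul_le_mul_right ?_ hα
    linarith
  have hbi : b i ∈ Ioc 0 (E.maxBid i) := ⟨hi, (hb i).2⟩
  have hself : Function.update b i (b i) = b := Function.update_eq_self i b
  rw [M.p_mul_x]
  rcases M.x_binary b i with hx | hx
  · rw [hx, M.p_eq_zero b i hx, intervalIntegral.integral_of_le hi.le,
      setIntegral_congr_fun (g := fun _ => (0 : ℝ)) measurableSet_Ioc]
    · simp
    · intro t ht
      rcases M.x_binary (Function.update b i t) i with h | h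
      · exact h
      -- The losing bid `b i` must not envy the report `t`, so the price at `t` is at least `b i`;
      -- individual rationality bounds it by `t`. Hence `t = b i`, which loses.
      · exfalso
        have hir := hM.2.1 _ (update_mem_bids hb (Ioc_subset_Icc_self (hsub t ht))) i
        have hy := hxt (hsub t ht) h
        have h1 := key hbi (hsub t ht) hy
        rw [hself, h, hx, M.p_eq_zero b i hx] at h1
        rw [Function.update_self] at hir
        have ht' : t = b i := le_antisymm ht.2 (by linarith)
        rw [ht', hself, hx] at h
        norm_num at h
  · have hy := hxt hbi (by rwa [hself])
    have hp0 := M.p_nonneg b i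
    have hpb := hM.2.1 b hb i
    -- The price is the threshold: a losing bid `t` does not envy the price `p b i`, and a winning
    -- `t` pays at least `p b i` and at most `t`. A tie at the threshold is a null set.
    have hind : ∀ᵐ t, t ∈ Ioc 0 (b i) →
        M.x (Function.update b i t) i = (Ioi (M.p b i)).indicator (fun _ => (1 : ℝ)) t := by
      filter_upwards [Measure.ae_ne volume (M.p b i)] with t hne ht
      rcases M.x_binary (Function.update b i t) i with h | h
      · have h1 := key (hsub t ht) hbi hy
        rw [hself, h, hx, M.p_eq_zero _ i h] at h1
        rw [h, indicator_of_notMem]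
        simp only [mem_Ioi, not_lt]
        linarith
      · have h1 := key hbi (hsub t ht) hy
        have hir := hM.2.1 _ (update_mem_bids hb (Ioc_subset_Icc_self (hsub t ht))) i
        rw [hself, h, hx] at h1
        rw [Function.update_self] at hir
        rw [h, indicator_of_mem]
        exact lt_of_le_of_ne (by linarith) hne.symm
    rw [hx, intervalIntegral.integral_of_le hi.le, setIntegral_congr_ae measurableSet_Ioc hind,
      setIntegral_indicator measurableSet_Ioi]
    have : Ioc 0 (b i) ∩ Ioi (M.p b i) = Ioc (M.p b i) (b i) := by
      ext t
      simp only [mem_inter_iff, mem_Ioc, mem_Ioi]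
      exact ⟨fun h => ⟨h.2, h.1.2⟩, fun h => ⟨⟨hp0.trans_lt h.1, h.2⟩, h.1⟩⟩
    rw [this]
    simp [hpb]

theorem IsAdmissible.integrable_payment (hM : E.IsAdmissible k M) (i : Fin n) :
    Integrable (fun b => M.p b i * M.x b i) E.jointPrior := by
  simp_rw [M.p_mul_x]
  refine Integrable.of_bound (M.measurable_p_apply i).aestronglyMeasurable (E.maxBid i) ?_
  filter_upwards [E.ae_mem_bids] with b hb
  rw [Real.norm_of_nonneg (M.p_nonneg b i)]
  exact (hM.2.1 b hb i).trans (hb i).2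

/-- The virtual surplus of an ad equals the expected payment for it. -/
theorem IsAdmissible.integral_payment (hM : E.IsAdmissible k M) (i : Fin n) :
    ∫ b, M.p b i * M.x b i * E.ctrAd i ∂E.jointPrior =
      ∫ b, M.x b i * (virtualValue (E.density i) (b i) * E.ctrAd i) ∂E.jointPrior := by
  rcases eq_or_lt_of_le (E.ctrAd_nonneg i) with hα | hα
  · simp [← hα]
  have hd := E.isRegularDensity i
  have hφ := integrable_mul_of_unit
    (integrable_comp_eval (E := E) (i := i) hd.integrable_virtualValue)
    (M.measurable_x_apply i) (fun b => M.x_nonneg b i) (fun b => M.x_le_one b i)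
  have hp := hM.integrable_payment i
  simp_rw [← mul_assoc, integral_mul_const]
  congr 1
  rw [jointPrior, integral_eq_integral_update E.prior i hp,
    integral_eq_integral_update E.prior i hφ]
  refine integral_congr_ae ?_
  filter_upwards [E.ae_mem_bids] with b hb
  have hx : Measurable fun t => M.x (Function.update b i t) i :=
    (M.measurable_x_apply i).comp (measurable_update b)
  simp only [Function.update_self]
  simp_rw [mul_comm (M.x _ _) (virtualValue _ _)]
  refine Eq.trans ?_ (hd.integral_payment hx (fun t => M.x_nonneg _ i) (fun t => M.x_le_one _ i))
  refine integral_congr_ae ?_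
  filter_upwards [hd.ae_mem_Ioo] with t ht
  have := hM.p_eq (update_mem_bids hb (Ioo_subset_Icc_self ht)) hα (i := i)
    (by simpa using ht.1)
  simpa using this

variable (E) in
theorem integrable_contribution (i : Fin n) :
    Integrable (fun b => E.contribution b i) E.jointPrior :=
  ((integrable_comp_eval (E.isRegularDensity i).integrable_virtualValue).mul_const _).add
    (integrable_const _)

theorem integrable_ad (M : Mechanism n) {g : (Fin n → ℝ) → ℝ} (hg : Integrable g E.jointPrior)
    (i : Fin n) : Integrable (fun b => M.x b i * g b) E.jointPrior :=
  integrable_mul_of_unit hg (M.measurable_x_apply i) (fun b => M.x_nonneg b i)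
    (fun b => M.x_le_one b i)

theorem integrable_org (M : Mechanism n) {g : (Fin n → ℝ) → ℝ} (hg : Integrable g E.jointPrior)
    (i : Fin n) : Integrable (fun b => M.y b i * g b) E.jointPrior :=
  integrable_mul_of_unit hg (M.measurable_y_apply i) (fun b => M.y_nonneg b i)
    (fun b => M.y_le_one b i)

/-- The objective of an admissible mechanism as expected virtual surplus. -/
theorem IsAdmissible.objective_eq (hM : E.IsAdmissible k M) :
    E.objective M = ∑ i, (∫ b, M.x b i * E.contribution b i ∂E.jointPrior +
      ∫ b, M.y b i * E.ueOrg i ∂E.jointPrior) := by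
  have hp := fun i => (hM.integrable_payment i).mul_const (E.ctrAd i)
  have hx := fun i => integrable_ad (E := E) M (integrable_const (E.ueAd i)) i
  have hy := fun i => integrable_org (E := E) M (integrable_const (E.ueOrg i)) i
  have hφ := fun i => integrable_ad (E := E) M ((integrable_comp_eval
    (E.isRegularDensity i).integrable_virtualValue).mul_const (E.ctrAd i)) i
  rw [objective, revenue, userExperience, integral_finsetSum _ fun i _ => hp i,
    integral_finsetSum (f := fun i b => M.x b i * E.ueAd i + M.y b i * E.ueOrg i) _
      fun i _ => (hx i).add (hy i), ← Finset.sum_add_distrib]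
  refine Finset.sum_congr rfl fun i _ => ?_
  rw [hM.integral_payment, integral_add (hx i) (hy i), ← add_assoc,
    ← integral_add (hφ i) (hx i)]
  simp only [contribution, mul_add]

end Admissible
end Instance

/-! ### Indices and capped values -/

namespace Instance

variable {n : ℕ} (E : Instance n)

/-- The virtual surplus of the ad form of item `i` at bid `s`, or zero if it is negative. -/
noncomputable def adValue (i : Fin n) (s : ℝ) : ℝ :=
  max (virtualValue (E.density i) s * E.ctrAd i + E.ueAd i) 0

theorem adValue_nonneg (i : Fin n) (s : ℝ) : 0 ≤ E.adValue i s := le_max_right _ _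

theorem max_contribution (b : Fin n → ℝ) (i : Fin n) :
    max (E.contribution b i) 0 = E.adValue i (b i) := rfl

theorem measurable_adValue (i : Fin n) : Measurable (E.adValue i) :=
  (((E.isRegularDensity i).measurable_virtualValue.mul_const _).add_const _).max
    measurable_const

theorem adValue_monotoneOn (i : Fin n) : MonotoneOn (E.adValue i) (Ioc 0 (E.maxBid i)) :=
  fun _ hs _ ht hst => max_le_max_right _ (add_le_add_left (mul_le_mul_of_nonneg_right
    ((E.isRegularDensity i).virtualValue_monotoneOn hs ht hst) (E.ctrAd_nonneg i)) _)

theorem integrable_adValue (i : Fin n) : Integrable (E.adValue i) (E.prior i) :=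
  have := (E.isRegularDensity i).isProbabilityMeasure
  (((E.isRegularDensity i).integrable_virtualValue.mul_const _).add (integrable_const _)).sup
    (integrable_const _)

theorem integrable_max_adValue (i : Fin n) (m : ℝ) :
    Integrable (fun s => max (E.adValue i s) m) (E.prior i) :=
  (E.integrable_adValue i).sup (integrable_const _)

theorem continuous_integral_max (i : Fin n) :
    Continuous fun m => ∫ s, max (E.adValue i s) m ∂E.prior i := by
  refine (LipschitzWith.of_dist_le_mul (K := 1) fun m m' => ?_).continuous
  rw [dist_eq_norm, ← integral_sub (E.integrable_max_adValue i m) (E.integrable_max_adValue i m')]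
  refine (norm_integral_le_of_norm_le_const (C := |m - m'|)
    (Filter.Eventually.of_forall fun s => ?_)).trans ?_
  · refine (abs_max_sub_max_le_max _ _ _ _).trans ?_
    simp
  · simp [Real.dist_eq]

/-- The index of an item: displaying item `i` organically is worth as much as receiving the larger
of the surplus of its ad and the index. A negative index means that the organic form is worth less
than the ad. -/
theorem exists_index (i : Fin n) : ∃ t : ℝ,
    E.ueOrg i ≤ ∫ s, max (E.adValue i s) t ∂E.prior i ∧
      (0 ≤ t → ∫ s, max (E.adValue i s) t ∂E.prior i = E.ueOrg i) := by
  have hc : 0 ≤ E.ueOrg i := (E.ueAd_nonneg i).trans (E.ueAd_le_ueOrg i)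
  rcases le_or_gt (∫ s, max (E.adValue i s) 0 ∂E.prior i) (E.ueOrg i) with h | h
  · have hup : E.ueOrg i ≤ ∫ s, max (E.adValue i s) (E.ueOrg i) ∂E.prior i := by
      have := integral_mono (integrable_const (E.ueOrg i))
        (E.integrable_max_adValue i (E.ueOrg i)) fun s => le_max_right (E.adValue i s) _
      simpa using this
    -- The expectation is at most `γ^O` at level `0` and at least `γ^O` at level `γ^O`.
    obtain ⟨t, -, ht⟩ := intermediate_value_Icc hc (E.continuous_integral_max i).continuousOn
      ⟨h, hup⟩
    exact ⟨t, ht.ge, fun _ => ht⟩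
  -- Here the ad alone is worth more than the organic form; `-1` is a marker, and any negative
  -- number would do since ad values are nonnegative.
  · refine ⟨-1, ?_, fun h => by norm_num at h⟩
    refine h.le.trans (le_of_eq (integral_congr_ae (Filter.Eventually.of_forall fun s => ?_)))
    have := E.adValue_nonneg i s
    simp only
    rw [max_eq_left this, max_eq_left (by linarith)]

/-- A choice of the index of item `i`. -/
noncomputable def index (i : Fin n) : ℝ := (E.exists_index i).choose

/-- The surplus of the ad form of item `i`, topped up to the index of item `i`. -/
noncomputable def capped (b : Fin n → ℝ) (i : Fin n) : ℝ :=
  max (E.adValue i (b i)) (E.index i)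

theorem ueOrg_le (i : Fin n) :
    E.ueOrg i ≤ ∫ s, max (E.adValue i s) (E.index i) ∂E.prior i :=
  (E.exists_index i).choose_spec.1

theorem integral_max_index {i : Fin n} (h : 0 ≤ E.index i) :
    ∫ s, max (E.adValue i s) (E.index i) ∂E.prior i = E.ueOrg i :=
  (E.exists_index i).choose_spec.2 h

theorem integrable_capped (i : Fin n) : Integrable (fun b => E.capped b i) E.jointPrior :=
  integrable_comp_eval (E.integrable_max_adValue i (E.index i))

theorem capped_nonneg (b : Fin n → ℝ) (i : Fin n) : 0 ≤ E.capped b i :=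
  (E.adValue_nonneg i _).trans (le_max_left _ _)

theorem contribution_le_adValue (b : Fin n → ℝ) (i : Fin n) :
    E.contribution b i ≤ E.adValue i (b i) := le_max_left _ _

variable {E} {k : ℕ} {M : Mechanism n}

/-- The organic allocation of item `i` is independent of the bid of its owner. -/
theorem IsAdmissible.integral_y_mul (hM : E.IsAdmissible k M) (i : Fin n) {g : ℝ → ℝ}
    (hg : Integrable g (E.prior i)) :
    ∫ b, M.y b i * g (b i) ∂E.jointPrior =
      (∫ b, M.y b i ∂E.jointPrior) * ∫ s, g s ∂E.prior i := by
  rw [jointPrior, integral_eq_integral_update E.prior i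
    (integrable_org (E := E) M (integrable_comp_eval hg) i), ← integral_mul_const]
  refine integral_congr_ae ?_
  filter_upwards [E.ae_mem_Ioo] with b hb
  rw [← integral_const_mul]
  refine integral_congr_ae ?_
  filter_upwards [(E.isRegularDensity i).ae_mem_Ioo] with t ht
  rw [hM.y_update (fun j => Ioo_subset_Icc_self (hb j)) (hb i).1 (Ioo_subset_Ioc_self ht),
    Function.update_self]

theorem IsAdmissible.integral_org_le (hM : E.IsAdmissible k M) (i : Fin n) :
    ∫ b, M.y b i * E.ueOrg i ∂E.jointPrior ≤ ∫ b, M.y b i * E.capped b i ∂E.jointPrior := by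
  unfold capped
  rw [hM.integral_y_mul i (E.integrable_max_adValue i (E.index i)), integral_mul_const]
  exact mul_le_mul_of_nonneg_left (E.ueOrg_le i) (integral_nonneg fun b => M.y_nonneg b i)

/-- With a negative index the capped value may overrate the organic form, so equality requires that
such an item never be shown organically. -/
theorem IsAdmissible.integral_org_eq_capped (hM : E.IsAdmissible k M) {i : Fin n}
    (h : ∀ b, M.y b i = 1 → 0 ≤ E.index i) :
    ∫ b, M.y b i * E.ueOrg i ∂E.jointPrior = ∫ b, M.y b i * E.capped b i ∂E.jointPrior := by
  rcases le_or_gt 0 (E.index i) with h0 | h0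
  · unfold capped
    rw [hM.integral_y_mul i (E.integrable_max_adValue i (E.index i)), integral_mul_const,
      E.integral_max_index h0]
  · have : ∀ b, M.y b i = 0 := fun b =>
      (M.y_binary b i).resolve_right fun hy => absurd (h b hy) h0.not_ge
    simp [this]

end Instance

/-! ### The upper bound by the two largest capped values -/

/-- The sum of the two largest of three numbers. -/
noncomputable def topTwo (v : Fin 3 → ℝ) : ℝ := max (v 0 + v 1) (max (v 0 + v 2) (v 1 + v 2))

theorem sum_mul_le_topTwo {v z : Fin 3 → ℝ} (hv : ∀ i, 0 ≤ v i)
    (hz : ∀ i, z i = 0 ∨ z i = 1) (hsum : ∑ i, z i ≤ 2) : ∑ i, z i * v i ≤ topTwo v := by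
  have h0 := hv 0
  have h1 := hv 1
  have h2 := hv 2
  simp only [Fin.sum_univ_three] at hsum ⊢
  unfold topTwo
  rcases hz 0 with h | h <;> rcases hz 1 with h' | h' <;> rcases hz 2 with h'' | h'' <;>
    simp only [h, h', h'', le_max_iff] at hsum ⊢ <;>
    first
      | (left; linarith)
      | (right; left; linarith)
      | (right; right; linarith)

theorem topTwo_le {v : Fin 3 → ℝ} {c : ℝ} (σ : Equiv.Perm (Fin 3))
    (h01 : v (σ 0) + v (σ 1) ≤ c) (h02 : v (σ 0) + v (σ 2) ≤ c) (h12 : v (σ 1) + v (σ 2) ≤ c) :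
    topTwo v ≤ c := by
  have key : ∀ i j, i ≠ j → v (σ i) + v (σ j) ≤ c := by
    intro i j hij
    fin_cases i <;> fin_cases j <;> simp at hij ⊢ <;> linarith
  have h : ∀ i j, i ≠ j → v i + v j ≤ c := by
    intro i j hij
    simpa using key (σ.symm i) (σ.symm j) (by simpa using hij)
  exact max_le (h 0 1 (by decide)) (max_le (h 0 2 (by decide)) (h 1 2 (by decide)))

namespace Instance

variable {E : Instance 3} {M : Mechanism 3}

variable (E) in
theorem integrable_topTwo : Integrable (fun b => topTwo (E.capped b)) E.jointPrior :=
  ((E.integrable_capped 0).add (E.integrable_capped 1)).sup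
    (((E.integrable_capped 0).add (E.integrable_capped 2)).sup
      ((E.integrable_capped 1).add (E.integrable_capped 2)))

theorem IsAdmissible.objective_le (hM : E.IsAdmissible 2 M) :
    E.objective M ≤ ∫ b, topTwo (E.capped b) ∂E.jointPrior := by
  have hx := fun i => integrable_ad (E := E) M (E.integrable_capped i) i
  have hy := fun i => integrable_org (E := E) M (E.integrable_capped i) i
  calc E.objective M
      ≤ ∑ i, (∫ b, M.x b i * E.capped b i ∂E.jointPrior +
          ∫ b, M.y b i * E.capped b i ∂E.jointPrior) := by
        rw [hM.objective_eq]
        refine Finset.sum_le_sum fun i _ => add_le_add ?_ (hM.integral_org_le i)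
        exact integral_mono (integrable_ad M (E.integrable_contribution i) i) (hx i) fun b =>
          mul_le_mul_of_nonneg_left ((E.contribution_le_adValue b i).trans (le_max_left _ _))
            (M.x_nonneg b i)
    _ = ∫ b, ∑ i, (M.x b i + M.y b i) * E.capped b i ∂E.jointPrior := by
        simp_rw [add_mul]
        rw [integral_finsetSum (f := fun i b => M.x b i * E.capped b i + M.y b i * E.capped b i) _
          fun i _ => (hx i).add (hy i)]
        exact Finset.sum_congr rfl fun i _ => (integral_add (hx i) (hy i)).symm
    _ ≤ ∫ b, topTwo (E.capped b) ∂E.jointPrior := by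
        refine integral_mono_ae ?_ E.integrable_topTwo ?_
        · simp_rw [add_mul]
          exact integrable_finsetSum _ fun i _ => (hx i).add (hy i)
        · filter_upwards [E.ae_mem_bids] with b hb
          have hf := hM.2.2 b hb
          refine sum_mul_le_topTwo (E.capped_nonneg b) (fun i => ?_) (by exact_mod_cast hf.1)
          have := hf.2 i
          rcases M.x_binary b i with h | h <;> rcases M.y_binary b i with h' | h' <;>
            rw [h, h'] at this ⊢ <;>
            first
              | (left; norm_num; done)
              | (right; norm_num; done)
              | (exfalso; linarith)

/-- A mechanism that attains the upper bound almost surely is optimal. -/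
theorem IsAdmissible.isOptimal (hM : E.IsAdmissible 2 M)
    (hidx : ∀ i b, M.y b i = 1 → 0 ≤ E.index i)
    (htop : ∀ᵐ b ∂E.jointPrior, topTwo (E.capped b) ≤
      ∑ i, (M.x b i * E.contribution b i + M.y b i * E.capped b i)) : E.IsOptimal 2 M := by
  refine ⟨hM, fun N hN => hN.objective_le.trans ?_⟩
  have hx := fun i => integrable_ad (E := E) M (E.integrable_contribution i) i
  have hy := fun i => integrable_org (E := E) M (E.integrable_capped i) i
  rw [hM.objective_eq]
  calc ∫ b, topTwo (E.capped b) ∂E.jointPrior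
      ≤ ∫ b, ∑ i, (M.x b i * E.contribution b i + M.y b i * E.capped b i) ∂E.jointPrior :=
        integral_mono_ae E.integrable_topTwo
          (integrable_finsetSum _ fun i _ => (hx i).add (hy i)) htop
    _ = _ := by
        rw [integral_finsetSum (f := fun i b =>
          M.x b i * E.contribution b i + M.y b i * E.capped b i) _ fun i _ => (hx i).add (hy i)]
        refine Finset.sum_congr rfl fun i _ => ?_
        rw [integral_add (hx i) (hy i), hM.integral_org_eq_capped (hidx i)]

end Instance

/-! ### Threshold payments for monotone allocations -/

section MonotoneAllocation

variable {B : ℝ} {X : ℝ → ℝ}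

theorem sub_mul_le_integral_sub (hX : Measurable X) (h0 : ∀ t, 0 ≤ X t) (h1 : ∀ t, X t ≤ 1)
    (hmono : MonotoneOn X (Icc 0 B)) {b c : ℝ} (hb : b ∈ Icc 0 B) (hc : c ∈ Icc 0 B) :
    (b - c) * X c ≤ (∫ t in (0 : ℝ)..b, X t) - ∫ t in (0 : ℝ)..c, X t := by
  have hint : ∀ r s : ℝ, IntervalIntegrable X volume r s := fun r s =>
    (intervalIntegrable_const (c := (1 : ℝ))).mono_fun hX.aestronglyMeasurable
      (Filter.Eventually.of_forall fun t => by
        simpa [abs_of_nonneg (h0 t)] using h1 t)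
  rw [intervalIntegral.integral_interval_sub_left (hint _ _) (hint _ _)]
  rcases le_total c b with h | h
  · have := intervalIntegral.integral_mono_on h intervalIntegrable_const (hint c b)
      fun t ht => hmono hc ⟨hc.1.trans ht.1, ht.2.trans hb.2⟩ ht.1
    simpa using this
  · rw [intervalIntegral.integral_symm]
    have := intervalIntegral.integral_mono_on h (hint b c) intervalIntegrable_const
      fun t ht => hmono ⟨hb.1.trans ht.1, ht.2.trans hc.2⟩ hc ht.2
    rw [intervalIntegral.integral_const, smul_eq_mul] at this
    linarith

/-- A losing bid has only losing bids below it, so the factor `x` in the payment of the index policy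
does not alter the Myerson integral. -/
theorem mul_integral_eq (h : ∀ t, X t = 0 ∨ X t = 1) (hmono : MonotoneOn X (Icc 0 B)) {c : ℝ}
    (hc : c ∈ Icc 0 B) : X c * ∫ t in (0 : ℝ)..c, X t = ∫ t in (0 : ℝ)..c, X t := by
  rcases h c with hX | hX
  · rw [intervalIntegral.integral_of_le hc.1,
      setIntegral_congr_fun (g := fun _ => (0 : ℝ)) measurableSet_Ioc]
    · simp
    · intro t ht
      have := hmono ⟨ht.1.le, ht.2.trans hc.2⟩ hc ht.2
      rcases h t with h' | h'
      · exact h'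
      · rw [hX, h'] at this; norm_num at this
  · rw [hX, one_mul]

theorem setIntegral_mem_Icc (h0 : ∀ t, 0 ≤ X t) (h1 : ∀ t, X t ≤ 1) {c : ℝ} (hc : 0 ≤ c) :
    ∫ t in Ioc 0 c, X t ∈ Icc 0 c := by
  refine ⟨integral_nonneg h0, ?_⟩
  have := norm_setIntegral_le_of_norm_le_const (μ := volume) (s := Ioc 0 c) (f := X) (C := 1)
    (by simp) fun t _ => by rw [Real.norm_of_nonneg (h0 t)]; exact h1 t
  rw [Real.norm_of_nonneg (integral_nonneg h0)] at this
  simpa [hc] using this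

end MonotoneAllocation

namespace Instance

/-! ### The index policy: admissibility and optimality -/

section IndexMechanism

variable (E : Instance 3) (σ : Equiv.Perm (Fin 3))

/-- The organic allocation of the index policy with the order `σ`. -/
def Organic (b : Fin 3 → ℝ) (i : Fin 3) : Prop :=
  (i = σ 0 ∧ min (E.adValue (σ 1) (b (σ 1))) (E.adValue (σ 2) (b (σ 2))) ≤ E.index (σ 0)) ∨
    (i = σ 1 ∧ E.adValue (σ 2) (b (σ 2)) ≤ E.index (σ 1))

/-- The ad of item `j` precedes that of item `i`. -/
def Precedes (b : Fin 3 → ℝ) (j i : Fin 3) : Prop :=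
  E.adValue i (b i) < E.adValue j (b j) ∨ (E.adValue i (b i) = E.adValue j (b j) ∧ j < i)

/-- The ad of item `i` is displayed: it has positive surplus and at least one other item neither
is displayed organically nor precedes it. -/
def Displayed (b : Fin 3 → ℝ) (i : Fin 3) : Prop :=
  b ∈ E.bids ∧ 0 < b i ∧ 0 < E.adValue i (b i) ∧ ¬ E.Organic σ b i ∧
    ∃ j, j ≠ i ∧ ¬ E.Organic σ b j ∧ ¬ E.Precedes b j i

open Classical in
noncomputable def indexX (b : Fin 3 → ℝ) (i : Fin 3) : ℝ := if E.Displayed σ b i then 1 else 0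

open Classical in
noncomputable def indexY (b : Fin 3 → ℝ) (i : Fin 3) : ℝ := if E.Organic σ b i then 1 else 0

/-- The Myerson payment. -/
noncomputable def indexP (b : Fin 3 → ℝ) (i : Fin 3) : ℝ :=
  E.indexX σ b i * (b i - ∫ t in Ioc 0 (b i), E.indexX σ (Function.update b i t) i)

theorem indexX_binary (b i) : E.indexX σ b i = 0 ∨ E.indexX σ b i = 1 := by
  unfold indexX; split_ifs <;> simp

theorem indexY_binary (b i) : E.indexY σ b i = 0 ∨ E.indexY σ b i = 1 := by
  unfold indexY; split_ifs <;> simp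

theorem indexX_nonneg (b i) : 0 ≤ E.indexX σ b i := by
  rcases E.indexX_binary σ b i with h | h <;> simp [h]

theorem indexX_le_one (b i) : E.indexX σ b i ≤ 1 := by
  rcases E.indexX_binary σ b i with h | h <;> simp [h]

theorem indexX_eq_one {b i} : E.indexX σ b i = 1 ↔ E.Displayed σ b i := by
  simp [indexX]

theorem indexY_eq_one {b i} : E.indexY σ b i = 1 ↔ E.Organic σ b i := by
  simp [indexY]

theorem measurable_adValue_apply (i : Fin 3) : Measurable fun b : Fin 3 → ℝ => E.adValue i (b i) :=
  (E.measurable_adValue i).comp (measurable_pi_apply i)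

theorem measurableSet_bids : MeasurableSet E.bids := by
  have : E.bids = univ.pi fun i => Icc 0 (E.maxBid i) := by
    ext b; simp only [bids, mem_ofPred_eq, mem_pi, mem_univ, true_implies]
  rw [this]
  exact MeasurableSet.univ_pi fun i => measurableSet_Icc

theorem measurableSet_organic (i : Fin 3) : MeasurableSet {b | E.Organic σ b i} :=
  ((MeasurableSet.const _).inter (measurableSet_le ((E.measurable_adValue_apply _).min
    (E.measurable_adValue_apply _)) measurable_const)).union
    ((MeasurableSet.const _).inter (measurableSet_le (E.measurable_adValue_apply _)
      measurable_const))

theorem measurableSet_precedes (j i : Fin 3) : MeasurableSet {b | E.Precedes b j i} :=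
  (measurableSet_lt (E.measurable_adValue_apply _) (E.measurable_adValue_apply _)).union
    ((measurableSet_eq_fun (E.measurable_adValue_apply _) (E.measurable_adValue_apply _)).inter
      (MeasurableSet.const _))

theorem measurableSet_displayed (i : Fin 3) : MeasurableSet {b | E.Displayed σ b i} := by
  have h : MeasurableSet {b | ∃ j, j ≠ i ∧ ¬ E.Organic σ b j ∧ ¬ E.Precedes b j i} := by
    rw [ofPred_exists]
    exact MeasurableSet.iUnion fun j => (MeasurableSet.const _).inter
      ((E.measurableSet_organic σ j).compl.inter (E.measurableSet_precedes j i).compl)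
  exact E.measurableSet_bids.inter ((measurableSet_lt measurable_const
    (measurable_pi_apply i)).inter ((measurableSet_lt measurable_const
    (E.measurable_adValue_apply i)).inter ((E.measurableSet_organic σ i).compl.inter h)))

theorem measurable_indexX : Measurable (E.indexX σ) :=
  measurable_pi_iff.2 fun i =>
    Measurable.ite (E.measurableSet_displayed σ i) measurable_const measurable_const

theorem measurable_indexY : Measurable (E.indexY σ) :=
  measurable_pi_iff.2 fun i =>
    Measurable.ite (E.measurableSet_organic σ i) measurable_const measurable_const

theorem measurable_indexP : Measurable (E.indexP σ) := by
  refine measurable_pi_iff.2 fun i => ?_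
  have hx : Measurable fun b => E.indexX σ b i :=
    (measurable_pi_apply i).comp (E.measurable_indexX σ)
  refine hx.mul ((measurable_pi_apply i).sub ?_)
  have hupd : Measurable fun q : (Fin 3 → ℝ) × ℝ => Function.update q.1 i q.2 :=
    (measurePreserving_update E.prior i).measurable
  have hset : MeasurableSet {q : (Fin 3 → ℝ) × ℝ | q.2 ∈ Ioc 0 (q.1 i)} :=
    (measurableSet_lt measurable_const measurable_snd).inter
      (measurableSet_le measurable_snd ((measurable_pi_apply i).comp measurable_fst))
  have hm : Measurable (Function.uncurry fun (b : Fin 3 → ℝ) (t : ℝ) =>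
      (Ioc 0 (b i)).indicator (fun t => E.indexX σ (Function.update b i t) i) t) :=
    (hx.comp hupd).indicator hset
  have := (hm.stronglyMeasurable.integral_prod_right (ν := volume)).measurable
  simpa only [integral_indicator measurableSet_Ioc] using this

theorem indexP_nonneg (b i) : 0 ≤ E.indexP σ b i := by
  unfold indexP
  rcases E.indexX_binary σ b i with h | h
  · simp [h]
  · have hb := ((E.indexX_eq_one σ).1 h).2.1
    rw [h, one_mul, sub_nonneg]
    exact (setIntegral_mem_Icc (fun t => E.indexX_nonneg σ _ i)
      (fun t => E.indexX_le_one σ _ i) hb.le).2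

/-- The index policy with the order `σ`. -/
noncomputable def indexMechanism : Mechanism 3 where
  x := E.indexX σ
  y := E.indexY σ
  p := E.indexP σ
  x_binary := E.indexX_binary σ
  y_binary := E.indexY_binary σ
  p_nonneg := E.indexP_nonneg σ
  p_eq_zero b i h := by simp [indexP, h]
  measurable_x := E.measurable_indexX σ
  measurable_y := E.measurable_indexY σ
  measurable_p := E.measurable_indexP σ

variable {E σ}

theorem organic_update_self {b : Fin 3 → ℝ} {i : Fin 3} {t : ℝ} :
    E.Organic σ (Function.update b i t) i ↔ E.Organic σ b i := by
  unfold Organic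
  refine or_congr (and_congr_right ?_) (and_congr_right ?_) <;> rintro rfl <;>
    simp [Function.update_of_ne]

theorem adValue_le_update {b : Fin 3 → ℝ} {i : Fin 3} {t : ℝ} (hi : 0 < b i) (hit : b i ≤ t)
    (ht : t ≤ E.maxBid i) (j : Fin 3) :
    E.adValue j (b j) ≤ E.adValue j (Function.update b i t j) := by
  by_cases h : j = i
  · subst h
    rw [Function.update_self]
    exact E.adValue_monotoneOn j ⟨hi, hit.trans ht⟩ ⟨hi.trans_le hit, ht⟩ hit
  · rw [Function.update_of_ne h]

/-- The organic tests bound ad values from above, so a higher bid can only remove organic displays.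
-/
theorem Organic.of_update {b : Fin 3 → ℝ} {i j : Fin 3} {t : ℝ} (hi : 0 < b i) (hit : b i ≤ t)
    (ht : t ≤ E.maxBid i) (h : E.Organic σ (Function.update b i t) j) : E.Organic σ b j :=
  h.imp
    (And.imp_right (min_le_min (adValue_le_update hi hit ht _)
      (adValue_le_update hi hit ht _)).trans)
    (And.imp_right (adValue_le_update hi hit ht _).trans)

/-- After a higher bid the witness `j` is still not organic and still does not precede `i`, whose
own organic test ignores its bid. -/
theorem Displayed.update {b : Fin 3 → ℝ} {i : Fin 3} {t : ℝ} (h : E.Displayed σ b i)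
    (hit : b i ≤ t) (ht : t ≤ E.maxBid i) : E.Displayed σ (Function.update b i t) i := by
  obtain ⟨hb, hi, hv, ho, j, hj, hoj, hp⟩ := h
  have hle := adValue_le_update hi hit ht i
  refine ⟨update_mem_bids hb ⟨hi.le.trans hit, ht⟩, ?_, hv.trans_le hle,
    fun h => ho (organic_update_self.1 h), j, hj, fun h => hoj (h.of_update hi hit ht), ?_⟩
  · rw [Function.update_self]; exact hi.trans_le hit
  · intro h
    apply hp
    unfold Precedes at h ⊢
    rw [Function.update_of_ne hj] at h
    rcases h with h | ⟨h, hlt⟩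
    · exact Or.inl (hle.trans_lt h)
    · rcases hle.lt_or_eq with h' | h'
      · exact Or.inl (h'.trans_eq h)
      · exact Or.inr ⟨h'.trans h, hlt⟩

/-- This covers the bid `0` only because `Displayed` demands a positive bid; ad values need not be
monotone there. -/
theorem indexX_monotoneOn (b : Fin 3 → ℝ) (i : Fin 3) :
    MonotoneOn (fun t => E.indexX σ (Function.update b i t) i) (Icc 0 (E.maxBid i)) := by
  intro s _ t ht hst
  rcases E.indexX_binary σ (Function.update b i s) i with h | h
  · simp only [h]; exact E.indexX_nonneg σ _ i
  · have := ((E.indexX_eq_one σ).1 h).update (t := t) (by simpa using hst) ht.2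
    rw [Function.update_idem] at this
    simp only [h, (E.indexX_eq_one σ).2 this, le_refl]

theorem indexP_update {b : Fin 3 → ℝ} {i : Fin 3} {c : ℝ} (hc : c ∈ Icc 0 (E.maxBid i)) :
    E.indexP σ (Function.update b i c) i = E.indexX σ (Function.update b i c) i * c -
      ∫ t in (0 : ℝ)..c, E.indexX σ (Function.update b i t) i := by
  have h := mul_integral_eq (fun t => E.indexX_binary σ (Function.update b i t) i)
    (indexX_monotoneOn b i) hc
  unfold indexP
  simp only [Function.update_self, Function.update_idem]
  rw [mul_sub, ← intervalIntegral.integral_of_le hc.1, h]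

theorem indexMechanism_isIC : E.IsIC (E.indexMechanism σ) := by
  intro b hb i c hc
  have hy : E.indexY σ (Function.update b i c) i = E.indexY σ b i := by
    unfold indexY
    congr 1
    exact propext organic_update_self
  have hself : Function.update b i (b i) = b := Function.update_eq_self i b
  have hPx : ∀ b', (E.indexMechanism σ).p b' i * ((E.indexMechanism σ).x b' i * E.ctrAd i) =
      E.indexP σ b' i * E.ctrAd i := fun b' => by
    rw [← mul_assoc, Mechanism.p_mul_x]; rfl
  have hPc := indexP_update (E := E) (σ := σ) (b := b) hc
  have hPb := indexP_update (E := E) (σ := σ) (b := b) (hb i)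
  rw [hself] at hPb
  have hX : Measurable fun t => E.indexX σ (Function.update b i t) i :=
    ((measurable_pi_apply i).comp (E.measurable_indexX σ)).comp (measurable_update b)
  have key := sub_mul_le_integral_sub hX (fun t => E.indexX_nonneg σ _ i)
    (fun t => E.indexX_le_one σ _ i) (indexX_monotoneOn b i) (hb i) hc
  simp only [clickRate, payment, hPx]
  change b i * (E.indexX σ _ i * _ + E.indexY σ _ i * _) - _ ≤
    b i * (E.indexX σ _ i * _ + E.indexY σ _ i * _) - _
  rw [hy, hPc, hPb]
  have := mul_le_mul_of_nonneg_right key (E.ctrAd_nonneg i)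
  nlinarith

theorem indexMechanism_isIR : E.IsIR (E.indexMechanism σ) := by
  intro b hb i
  change E.indexX σ b i * _ ≤ _
  have h := setIntegral_mem_Icc (X := fun t => E.indexX σ (Function.update b i t) i)
    (fun t => E.indexX_nonneg σ _ i) (fun t => E.indexX_le_one σ _ i) (hb i).1
  rcases E.indexX_binary σ b i with h' | h'
  · rw [h', zero_mul]; exact (hb i).1
  · rw [h', one_mul]; linarith [h.1]

theorem not_organic_last (b : Fin 3 → ℝ) : ¬ E.Organic σ b (σ 2) := by
  simp [Organic]

theorem precedes_or (b : Fin 3 → ℝ) {i j : Fin 3} (hij : i ≠ j) :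
    E.Precedes b i j ∨ E.Precedes b j i := by
  unfold Precedes
  rcases lt_trichotomy (E.adValue i (b i)) (E.adValue j (b j)) with h | h | h
  · exact Or.inr (Or.inl h)
  · rcases lt_or_gt_of_ne hij with h' | h'
    · exact Or.inl (Or.inr ⟨h.symm, h'⟩)
    · exact Or.inr (Or.inr ⟨h, h'⟩)
  · exact Or.inl (Or.inl h)

/-- Some item is not displayed at all. -/
theorem exists_not_displayed (b : Fin 3 → ℝ) :
    ∃ i, ¬ E.Organic σ b i ∧ ¬ E.Displayed σ b i := by
  classical
  -- The last non-organic item in the order `Precedes`: smallest ad value and, among ties, largest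
  -- number, hence the order dual. The set is nonempty since `σ 2` is never organic.
  obtain ⟨i, hi, hmin⟩ := Finset.exists_min_image
    (Finset.univ.filter fun i => ¬ E.Organic σ b i)
    (fun i => toLex (E.adValue i (b i), OrderDual.toDual i))
    ⟨σ 2, by simpa using not_organic_last b⟩
  refine ⟨i, by simpa using hi, ?_⟩
  rintro ⟨-, -, -, -, j, hj, hoj, hp⟩
  apply hp
  have := hmin j (by simpa using hoj)
  rw [Prod.Lex.toLex_le_toLex] at this
  rcases this with h | ⟨h, h'⟩
  · exact Or.inl h
  · exact Or.inr ⟨h, lt_of_le_of_ne (OrderDual.toDual_le_toDual.1 h') hj⟩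

theorem indexMechanism_isFeasible : E.IsFeasible 2 (E.indexMechanism σ) := by
  intro b _
  have hle : ∀ i, E.indexX σ b i + E.indexY σ b i ≤ 1 := by
    intro i
    by_cases h : E.Organic σ b i
    · have : ¬ E.Displayed σ b i := fun h' => h'.2.2.2.1 h
      simp [indexX, indexY, h, this]
    · simpa [indexY, h] using E.indexX_le_one σ b i
  refine ⟨?_, hle⟩
  obtain ⟨i, ho, hd⟩ := exists_not_displayed (E := E) (σ := σ) b
  change ∑ i, (E.indexX σ b i + E.indexY σ b i) ≤ _
  rw [← Finset.add_sum_erase _ _ (Finset.mem_univ i)]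
  have h0 : E.indexX σ b i + E.indexY σ b i = 0 := by simp [indexX, indexY, ho, hd]
  rw [h0, zero_add]
  refine (Finset.sum_le_card_nsmul _ _ 1 fun j _ => hle j).trans ?_
  simp

theorem indexMechanism_isAdmissible : E.IsAdmissible 2 (E.indexMechanism σ) :=
  ⟨indexMechanism_isIC, indexMechanism_isIR, indexMechanism_isFeasible⟩

theorem indexX_mul_contribution (b : Fin 3 → ℝ) (i : Fin 3) :
    E.indexX σ b i * E.contribution b i = E.indexX σ b i * E.adValue i (b i) := by
  rcases E.indexX_binary σ b i with h | h
  · simp [h]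
  · have := ((E.indexX_eq_one σ).1 h).2.2.1
    rw [← max_contribution] at this ⊢
    rcases max_choice (E.contribution b i) 0 with h' | h'
    · rw [h']
    · rw [h'] at this; exact absurd this (lt_irrefl 0)

theorem indexX_mul_adValue {b : Fin 3 → ℝ} (hb : ∀ i, b i ∈ Ioo 0 (E.maxBid i)) {i j : Fin 3}
    (hij : i ≠ j) (hi : ¬ E.Organic σ b i) (hj : ¬ E.Organic σ b j) (h : E.Precedes b i j) :
    E.indexX σ b i * E.adValue i (b i) = E.adValue i (b i) ∧
      E.adValue j (b j) ≤ E.adValue i (b i) := by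
  refine ⟨?_, h.elim le_of_lt fun h => h.1.le⟩
  rcases (E.adValue_nonneg i (b i)).eq_or_lt with h0 | h0
  · rw [← h0, mul_zero]
  · rw [(E.indexX_eq_one σ).2, one_mul]
    refine ⟨fun k => Ioo_subset_Icc_self (hb k), (hb i).1, h0, hi, j, hij.symm, hj, ?_⟩
    unfold Precedes at h ⊢
    rintro (h' | h') <;> rcases h with h | h
    · exact lt_asymm h h'
    · exact h'.ne h.1.symm
    · exact h.ne h'.1.symm
    · exact lt_asymm h.2 h'.2

/-- If `σ 1` is organic, so is `σ 0`, and the capped value of `σ 2` is at most the index of `σ 1`,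
hence the smallest. If only `σ 0` is organic, its capped value is at least the smaller of the other
two, and the better remaining ad realises the larger. If none is, the ads of `σ 1` and `σ 2` beat
the index of `σ 0`, so the two best ads realise the bound. -/
theorem topTwo_le_surplus (h01 : E.index (σ 1) ≤ E.index (σ 0))
    (h12 : E.index (σ 2) ≤ E.index (σ 1)) {b : Fin 3 → ℝ}
    (hb : ∀ i, b i ∈ Ioo 0 (E.maxBid i)) : topTwo (E.capped b) ≤
      ∑ i, (E.indexX σ b i * E.contribution b i + E.indexY σ b i * E.capped b i) := by
  simp_rw [indexX_mul_contribution]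
  rw [← Equiv.sum_comp σ, Fin.sum_univ_three]
  have hn : ∀ i, 0 ≤ E.indexX σ b i * E.adValue i (b i) := fun i =>
    mul_nonneg (E.indexX_nonneg σ b i) (E.adValue_nonneg i _)
  have hdom := fun (i j : Fin 3) (hij : i ≠ j) (hi : ¬ E.Organic σ b i)
    (hj : ¬ E.Organic σ b j) => (precedes_or (E := E) b hij).imp
      (indexX_mul_adValue (σ := σ) hb hij hi hj) (indexX_mul_adValue (σ := σ) hb hij.symm hj hi)
  have ne01 : σ 0 ≠ σ 1 := by simp
  have ne02 : σ 0 ≠ σ 2 := by simp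
  have ne12 : σ 1 ≠ σ 2 := by simp
  have ho2 : ¬ E.Organic σ b (σ 2) := not_organic_last b
  have hy2 : E.indexY σ b (σ 2) = 0 := by simp [indexY, ho2]
  have hiff0 : E.Organic σ b (σ 0) ↔
      min (E.adValue (σ 1) (b (σ 1))) (E.adValue (σ 2) (b (σ 2))) ≤ E.index (σ 0) := by
    simp [Organic]
  have hiff1 : E.Organic σ b (σ 1) ↔ E.adValue (σ 2) (b (σ 2)) ≤ E.index (σ 1) := by
    simp [Organic]
  have hn0 := hn (σ 0)
  have hn1 := hn (σ 1)
  have hn2 := hn (σ 2)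
  have hd01 := hdom _ _ ne01
  have hd02 := hdom _ _ ne02
  have hd12 := hdom _ _ ne12
  by_cases ho1 : E.Organic σ b (σ 1)
  · have hv := hiff1.1 ho1
    have ho0 : E.Organic σ b (σ 0) := hiff0.2 ((min_le_right _ _).trans (hv.trans h01))
    have hy0 : E.indexY σ b (σ 0) = 1 := (E.indexY_eq_one σ).2 ho0
    have hy1 : E.indexY σ b (σ 1) = 1 := (E.indexY_eq_one σ).2 ho1
    rw [hy0, hy1, hy2]
    have hκ1 : E.index (σ 1) ≤ E.capped b (σ 1) := le_max_right _ _
    have hκ0 : E.index (σ 0) ≤ E.capped b (σ 0) := le_max_right _ _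
    have hκ2 : E.capped b (σ 2) ≤ E.index (σ 1) := max_le hv h12
    apply topTwo_le σ <;> linarith
  · have hv : E.index (σ 1) < E.adValue (σ 2) (b (σ 2)) := not_le.1 fun h => ho1 (hiff1.2 h)
    have hy1 : E.indexY σ b (σ 1) = 0 := by simp [indexY, ho1]
    have hκ2 : E.capped b (σ 2) = E.adValue (σ 2) (b (σ 2)) := max_eq_left (h12.trans hv.le)
    specialize hd12 ho1 ho2
    by_cases ho0 : E.Organic σ b (σ 0)
    · have hy0 : E.indexY σ b (σ 0) = 1 := (E.indexY_eq_one σ).2 ho0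
      have hκ0 : E.index (σ 0) ≤ E.capped b (σ 0) := le_max_right _ _
      rw [hy0, hy1, hy2]
      have hmin := hiff0.1 ho0
      rcases le_total (E.adValue (σ 1) (b (σ 1))) (E.index (σ 1)) with h | h
      · have hκ1 : E.capped b (σ 1) = E.index (σ 1) := max_eq_right h
        apply topTwo_le σ <;> rcases hd12 with ⟨_, _⟩ | ⟨_, _⟩ <;> linarith
      · have hκ1 : E.capped b (σ 1) = E.adValue (σ 1) (b (σ 1)) := max_eq_left h
        apply topTwo_le σ <;> rcases hd12 with ⟨_, _⟩ | ⟨_, _⟩ <;>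
          rcases min_le_iff.1 hmin with _ | _ <;> linarith
    · have hy0 : E.indexY σ b (σ 0) = 0 := by simp [indexY, ho0]
      have hmin := not_le.1 fun h => ho0 (hiff0.2 h)
      obtain ⟨hv1, hv2⟩ := lt_min_iff.1 hmin
      have hκ1 : E.capped b (σ 1) = E.adValue (σ 1) (b (σ 1)) := max_eq_left (h01.trans hv1.le)
      specialize hd01 ho0 ho1
      specialize hd02 ho0 ho2
      rw [hy0, hy1, hy2]
      rcases max_choice (E.adValue (σ 0) (b (σ 0))) (E.index (σ 0)) with h | h <;>
        have hκ0 := h <;> change E.capped b (σ 0) = _ at hκ0 <;>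
        apply topTwo_le σ <;> rcases hd12 with ⟨_, _⟩ | ⟨_, _⟩ <;>
        rcases hd01 with ⟨_, _⟩ | ⟨_, _⟩ <;> rcases hd02 with ⟨_, _⟩ | ⟨_, _⟩ <;> linarith

theorem indexMechanism_isOptimal (h01 : E.index (σ 1) ≤ E.index (σ 0))
    (h12 : E.index (σ 2) ≤ E.index (σ 1)) : E.IsOptimal 2 (E.indexMechanism σ) := by
  refine indexMechanism_isAdmissible.isOptimal (fun i b hy => ?_)
    (E.ae_mem_Ioo.mono fun b hb => topTwo_le_surplus h01 h12 hb)
  rcases (E.indexY_eq_one σ).1 hy with ⟨rfl, h⟩ | ⟨rfl, h⟩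
  · exact (le_min (E.adValue_nonneg _ _) (E.adValue_nonneg _ _)).trans h
  · exact (E.adValue_nonneg _ _).trans h

theorem exists_orderedAt_indexMechanism (h01 : E.index (σ 1) ≤ E.index (σ 0)) :
    ∃ (g₁ : ℝ → ℝ → ℝ) (g₂ : ℝ → ℝ), ∀ b,
      OrderedAt E (E.indexMechanism σ) (σ 0) (σ 1) (σ 2) g₁ g₂ b := by
  classical
  -- The contributions are truncated at `0` because the organic tests are stated in terms of
  -- `adValue`.
  refine ⟨fun r s => if min (max r 0) (max s 0) ≤ E.index (σ 0) then 1 else 0,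
    fun s => if max s 0 ≤ E.index (σ 1) then 1 else 0, fun b => ?_⟩
  have h0 : E.indexY σ b (σ 0) = if min (E.adValue (σ 1) (b (σ 1)))
      (E.adValue (σ 2) (b (σ 2))) ≤ E.index (σ 0) then 1 else 0 := by
    simp [indexY, Organic]
  have h1 : E.indexY σ b (σ 1) =
      if E.adValue (σ 2) (b (σ 2)) ≤ E.index (σ 1) then 1 else 0 := by
    simp [indexY, Organic]
  have h2 : E.indexY σ b (σ 2) = 0 := by simp [indexY, not_organic_last]
  refine ⟨?_, ?_, h0, h1, h2⟩
  · change E.indexY σ b (σ 1) ≤ E.indexY σ b (σ 0)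
    rw [h0, h1]
    by_cases h : E.adValue (σ 2) (b (σ 2)) ≤ E.index (σ 1)
    · rw [if_pos h, if_pos ((min_le_right _ _).trans (h.trans h01))]
    · rw [if_neg h]; split_ifs <;> simp
  · change E.indexY σ b (σ 2) ≤ E.indexY σ b (σ 1)
    rw [h1, h2]
    split_ifs <;> simp

end IndexMechanism

variable (E : Instance 3)

theorem exists_index_order : ∃ σ : Equiv.Perm (Fin 3),
    E.index (σ 1) ≤ E.index (σ 0) ∧ E.index (σ 2) ≤ E.index (σ 1) := by
  have h := Tuple.monotone_sort fun i => -E.index i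
  refine ⟨Tuple.sort fun i => -E.index i, ?_, ?_⟩
  · simpa using h (show (0 : Fin 3) ≤ 1 by decide)
  · simpa using h (show (1 : Fin 3) ≤ 2 by decide)

end Instance

end MergingProblem

theorem mainTheorem5 (E : MergingProblem.Instance 3) :
    (∃ M : MergingProblem.Mechanism 3, E.IsOptimal 2 M ∧
      ∃ (σ : Equiv.Perm (Fin 3)) (g₁ : ℝ → ℝ → ℝ) (g₂ : ℝ → ℝ),
        ∀ b ∈ E.bids, MergingProblem.OrderedAt E M (σ 0) (σ 1) (σ 2) g₁ g₂ b) ∧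
    (∀ M : MergingProblem.Mechanism 3, E.IsOptimal 2 M →
      (∀ N : MergingProblem.Mechanism 3, E.IsOptimal 2 N → ∀ᵐ b ∂E.jointPrior, N.y b = M.y b) →
      ∃ (σ : Equiv.Perm (Fin 3)) (g₁ : ℝ → ℝ → ℝ) (g₂ : ℝ → ℝ),
        ∀ᵐ b ∂E.jointPrior, MergingProblem.OrderedAt E M (σ 0) (σ 1) (σ 2) g₁ g₂ b) := by
  obtain ⟨σ, h01, h12⟩ := E.exists_index_order
  have hopt := MergingProblem.Instance.indexMechanism_isOptimal h01 h12
  obtain ⟨g₁, g₂, hord⟩ :=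
    MergingProblem.Instance.exists_orderedAt_indexMechanism (E := E) (σ := σ) h01
  refine ⟨⟨_, hopt, σ, g₁, g₂, fun b _ => hord b⟩, fun M _ huniq => ⟨σ, g₁, g₂, ?_⟩⟩
  filter_upwards [huniq _ hopt] with b hb
  have h := hord b
  unfold MergingProblem.OrderedAt at h ⊢
  rw [hb] at h
  exact h
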